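/- Let $d \ge 1$ be fixed and let $X^{(1)}, X^{(2)}, \dots$ be independent random vectors, each uniformly distributed on $[0,1)^d$ (that is, with independent coordinates, each uniform on $[0,1)$). For $x, y \in \mathbb{R}^d$ write $x \prec y$ if $x_j < y_j$ for all $j$, and $x \le y$ if $x_j \le y_j$ for all $j$. The record-setting region at time $n$ is $S_n := \{x \in [0,1)^d : x \not\prec X^{(i)} \text{ for all } 1 \le i \le n\}$, and the generators at time $n$ are the minimal elements of $S_n$ with respect to $\le$. Then the number of generators at time $n$ is finite and has finite expectation $\mathcal{G}_{d,n}$, and, as $n \to \infty$, \[ \mathcal{G}_{d,n} = (\ln n)^{d-1} \sum_{j=0}^{d-1} a_{d,j} (\ln n)^{-j} + O\bigl(n^{-1} (\ln n)^{d-1}\bigr), \] where, for $0 \le j \le d-1$, \[ a_{d,j} := \sum_{k=0}^{j} \binom{d}{d-j+k} \frac{(-1)^k\, \Gamma^{(k)}(d-j+k)}{k!\,(d-1-j)!}, \] and $\Gamma^{(k)}$ denotes the $k$-th derivative of the Gamma function. In particular, $a_{d,0} = 1$. -/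

import Mathlib

open MeasureTheory ProbabilityTheory Filter Asymptotics
open scoped Nat

namespace ParetoRecords

/-- The half-open unit hypercube `[0, 1)^d`. -/
def unitCube (d : ℕ) : Set (Fin d → ℝ) :=
  Set.univ.pi fun _ => Set.Ico (0 : ℝ) 1

/-- The record-setting region after the first `n` observations `x 0, …, x (n - 1)`: the points
of `[0, 1)^d` that are not strictly below any of these observations in every coordinate. -/
def recordSettingRegion {d : ℕ} (x : ℕ → Fin d → ℝ) (n : ℕ) : Set (Fin d → ℝ) :=
  {y | y ∈ unitCube d ∧ ∀ i < n, ¬ StrongLT y (x i)}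

/-- The generators after the first `n` observations: the minimal elements of the record-setting
region in the coordinatewise partial order. -/
def generators {d : ℕ} (x : ℕ → Fin d → ℝ) (n : ℕ) : Set (Fin d → ℝ) :=
  {g | Minimal (· ∈ recordSettingRegion x n) g}

/-- The coefficient `a_{d,j}` (meant for `j ≤ d - 1`, where no subtraction truncates). -/
noncomputable def coeff (d j : ℕ) : ℝ :=
  ∑ k ∈ Finset.range (j + 1),
    (d.choose (d - j + k) : ℝ) *
      ((-1) ^ k * iteratedDeriv k Real.Gamma ((d - j + k : ℕ) : ℝ) /
        ((k ! : ℝ) * ((d - 1 - j)! : ℝ)))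

end ParetoRecords

/-!
A positive coordinate of a generator `g` cannot be lowered, so it is provided by an observation that
exceeds `g` in all other coordinates; distinct coordinates use distinct observations. Almost surely
all entries lie in `(0, 1)` and no two observations share a coordinate, and then generators
correspond to pairs `(T, e)`: a set `T` of positive coordinates and an injection `e` from `T` to the
observations, subject to one condition on each observation (`GeneralPosition.ncard_generators`).

The condition for `(T, e)` with `T.card = a + 1` has an explicit probability. The coordinates of the
candidate point `g` are independent of all the other entries that the condition involves, so `g`
may be frozen. With `p = ∏ l ∈ T, (1 - g l)`, each of the `a + 1` observations in `e` exceeds `g` in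
its other coordinates of `T`, which has probability `p ^ a` in total, and each of the others fails
to exceed `g`, which has probability `1 - p`. As `p` is a product of `a + 1` independent uniform
variables, its density is `(-log p) ^ a / a!` (`map_prod_eq_uniformProdLaw`). Summing over `(T, e)`,
the expectation is the sum over `a < d` of `d.choose (a + 1) / a!` times
`n.descFactorial (a + 1) * logBeta a n` (`integral_ncard_generators`).

After the substitution `p = t / n`, `n ^ (a + 1) * logBeta a n` is the integral of
`(1 - t / n) ^ (n - a - 1) * t ^ a * (log n - log t) ^ a`. Replacing the first factor by `exp (-t)`
costs a relative error `O((t ^ 2 + t) / n)`, hence `O(n⁻¹ * log n ^ a)` after integration. The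
resulting integral is a polynomial in `log n` whose coefficients are derivatives of the Gamma
function at `a + 1`, by differentiation of Euler's integral (`iteratedDeriv_Gamma`). Regrouping by
powers of `log n` gives the coefficients `coeff d j`.
-/

namespace ParetoRecords

open scoped ENNReal

/-! ### Generators and their supports -/

/-- The point whose coordinate `l` is that of the observation `e l` when `l ∈ T`, and `0` when
`l ∉ T`. -/
def corner {d n : ℕ} (x : ℕ → Fin d → ℝ) (T : Finset (Fin d)) (e : T ↪ Fin n) : Fin d → ℝ :=
  fun l => if h : l ∈ T then x (e ⟨l, h⟩) l else 0

/-- The condition on the `r`-th observation `y` for the point `g` with support `T` to be a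
generator whose coordinate `l ∈ T` comes from the observation `e l`. If `r` is a value of `e`, the
observation exceeds `g` in the coordinates of `T` other than the one it provides; if not, it fails
to exceed `g` in some coordinate of `T`. A single equivalence encodes both cases. -/
def rowSet {d n : ℕ} (T : Finset (Fin d)) (e : T ↪ Fin n) (g : Fin d → ℝ) (r : Fin n) :
    Set (Fin d → ℝ) :=
  {y | (∀ l : T, e l ≠ r → g l < y l) ↔ r ∈ Set.range e}

/-- The observations in `e` support a generator at `corner x T e`. -/
def IsSupport {d n : ℕ} (x : ℕ → Fin d → ℝ) (T : Finset (Fin d)) (e : T ↪ Fin n) : Prop :=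
  ∀ r : Fin n, x r ∈ rowSet T e (corner x T e) r

/-- The first `n` observations have coordinates in the open interval `(0, 1)`, and no two of them
share a coordinate. -/
def GeneralPosition {d : ℕ} (x : ℕ → Fin d → ℝ) (n : ℕ) : Prop :=
  (∀ (r : Fin n) (l : Fin d), x r l ∈ Set.Ioo (0 : ℝ) 1) ∧
    ∀ l : Fin d, Function.Injective fun r : Fin n => x r l

section Combinatorics

variable {d n : ℕ} {x : ℕ → Fin d → ℝ}

lemma corner_of_mem {T : Finset (Fin d)} (e : T ↪ Fin n) (l : T) :
    corner x T e l = x (e l) l := by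
  simp [corner]

lemma corner_of_notMem {T : Finset (Fin d)} (e : T ↪ Fin n) {l : Fin d} (hl : l ∉ T) :
    corner x T e l = 0 := by
  simp [corner, hl]

/-- If `g` is a generator with a positive coordinate `l`, lowering that coordinate slightly leaves
the record-setting region; as there are finitely many observations, one of them blocks every small
decrease, and this one has coordinate `l` equal to `g l` and dominates `g` elsewhere. -/
lemma exists_eq_of_mem_generators {g : Fin d → ℝ} (hg : g ∈ generators x n) {l : Fin d}
    (hl : g l ≠ 0) :
    ∃ r : Fin n, x r l = g l ∧ ∀ k, k ≠ l → g k < x r k := by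
  obtain ⟨⟨hcube, hdom⟩, hmin⟩ := hg
  have hpos : 0 < g l := lt_of_le_of_ne (hcube l trivial).1 (Ne.symm hl)
  by_contra! hcon
  -- the largest value below `g l` among `0` and the coordinates of the observations
  obtain ⟨c, hc0, hcl, hc⟩ : ∃ c, 0 ≤ c ∧ c < g l ∧ ∀ r : Fin n, x r l < g l → x r l ≤ c := by
    have key : ∀ s : Finset (Fin n),
        ∃ c, 0 ≤ c ∧ c < g l ∧ ∀ r ∈ s, x r l < g l → x r l ≤ c := by
      intro s
      induction s using Finset.induction_on with
      | empty => exact ⟨0, le_rfl, hpos, by simp⟩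
      | insert a s _ ih =>
        obtain ⟨c, h0, h1, h2⟩ := ih
        by_cases ha : x a l < g l
        · refine ⟨max c (x a l), le_max_of_le_left h0, max_lt h1 ha, ?_⟩
          intro r hr hrl
          rcases Finset.mem_insert.1 hr with rfl | hr
          · exact le_max_right _ _
          · exact le_max_of_le_left (h2 r hr hrl)
        · refine ⟨c, h0, h1, ?_⟩
          intro r hr hrl
          rcases Finset.mem_insert.1 hr with rfl | hr
          · exact absurd hrl ha
          · exact h2 r hr hrl
    obtain ⟨c, h0, h1, h2⟩ := key Finset.univ
    exact ⟨c, h0, h1, fun r => h2 r (Finset.mem_univ r)⟩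
  have hle : Function.update g l c ≤ g := by
    intro k
    by_cases hk : k = l
    · subst hk; simpa using hcl.le
    · simp [hk]
  have hmem : Function.update g l c ∈ recordSettingRegion x n := by
    refine ⟨fun k _ => ?_, fun i hi hlt => ?_⟩
    · by_cases hk : k = l
      · subst hk; simpa using ⟨hc0, hcl.trans (hcube k trivial).2⟩
      · simpa [hk] using hcube k trivial
    · have hcoord : ∀ k, k ≠ l → g k < x i k := fun k hk => by simpa [hk] using hlt k
      have hcl' : c < x i l := by simpa using hlt l
      have hge : g l ≤ x i l := by
        by_contra! hlt'
        exact absurd (hc ⟨i, hi⟩ hlt') (not_le.2 hcl')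
      rcases hge.eq_or_lt with heq | hgt
      · obtain ⟨k, hk, hk'⟩ := hcon ⟨i, hi⟩ heq.symm
        exact absurd (hcoord k hk) (not_lt.2 hk')
      · refine hdom i hi fun k => ?_
        by_cases hk : k = l
        · subst hk; exact hgt
        · exact hcoord k hk
  have := hmin hmem hle l
  simp only [Function.update_self] at this
  exact absurd this (not_le.2 hcl)

theorem finite_generators (x : ℕ → Fin d → ℝ) (n : ℕ) : (generators x n).Finite := by
  refine Set.Finite.subset (Set.Finite.pi' (t := fun l : Fin d =>
    insert (0 : ℝ) (Set.range fun r : Fin n => x r l)) fun l => ?_) ?_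
  · exact (Set.finite_range _).insert 0
  · intro g hg l
    by_cases hl : g l = 0
    · exact Or.inl hl
    · obtain ⟨r, hr, -⟩ := exists_eq_of_mem_generators hg hl
      exact Or.inr ⟨r, hr⟩

lemma GeneralPosition.corner_mem_generators (hx : GeneralPosition x n) {T : Finset (Fin d)}
    {e : T ↪ Fin n} (he : IsSupport x T e) : corner x T e ∈ generators x n := by
  have h0 : ∀ l, 0 ≤ corner x T e l := fun l => by
    by_cases hl : l ∈ T
    · rw [corner_of_mem e ⟨l, hl⟩]; exact (hx.1 _ _).1.le
    · rw [corner_of_notMem e hl]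
  refine ⟨⟨fun l _ => ⟨h0 l, ?_⟩, fun i hi hlt => ?_⟩, fun h hh hle l => ?_⟩
  · by_cases hl : l ∈ T
    · rw [corner_of_mem e ⟨l, hl⟩]; exact (hx.1 _ _).2
    · rw [corner_of_notMem e hl]; exact one_pos
  · obtain ⟨l, hl⟩ := (he ⟨i, hi⟩).1 fun l _ => hlt l
    have := hlt l
    rw [corner_of_mem, hl] at this
    exact lt_irrefl _ this
  · by_contra! hlt
    have hl : l ∈ T := by
      by_contra hl
      rw [corner_of_notMem e hl] at hlt
      exact absurd (hh.1 l trivial).1 (not_le.2 hlt)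
    refine hh.2 (e ⟨l, hl⟩) (e ⟨l, hl⟩).2 fun k => ?_
    by_cases hkl : k = l
    · subst hkl
      rwa [corner_of_mem e ⟨k, hl⟩] at hlt
    · refine (hle k).trans_lt ?_
      by_cases hk : k ∈ T
      · exact (he (e ⟨l, hl⟩)).2 ⟨_, rfl⟩ ⟨k, hk⟩ fun h => hkl (by simpa using e.injective h)
      · simpa [corner_of_notMem e hk] using (hx.1 (e ⟨l, hl⟩) k).1

lemma GeneralPosition.exists_isSupport (hx : GeneralPosition x n) {g : Fin d → ℝ}
    (hg : g ∈ generators x n) :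
    ∃ (T : Finset (Fin d)) (e : T ↪ Fin n), IsSupport x T e ∧ corner x T e = g := by
  classical
  have hr : ∀ l : (Finset.univ.filter fun l => g l ≠ 0),
      ∃ r : Fin n, x r l = g l ∧ ∀ k, k ≠ (l : Fin d) → g k < x r k := fun l =>
    exists_eq_of_mem_generators hg (Finset.mem_filter.1 l.2).2
  choose e he1 he2 using hr
  have hinj : Function.Injective e := by
    intro l k hlk
    by_contra hne
    have := he2 l k fun h => hne (Subtype.ext h.symm)
    rw [hlk, he1 k] at this
    exact lt_irrefl _ this
  have hcorner : corner x _ ⟨e, hinj⟩ = g := by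
    funext l
    by_cases hl : l ∈ Finset.univ.filter fun l => g l ≠ 0
    · rw [corner_of_mem _ ⟨l, hl⟩]; exact he1 ⟨l, hl⟩
    · rw [corner_of_notMem _ hl]; simpa using Eq.symm (by simpa using hl : g l = 0)
  refine ⟨_, ⟨e, hinj⟩, fun r => ?_, hcorner⟩
  rw [hcorner]
  constructor
  · intro h
    by_contra hrange
    -- an observation outside the range of `e` would dominate `g`
    have hall : ∀ l : (Finset.univ.filter fun l => g l ≠ 0), g l < x r l := fun l =>
      h l fun hl => hrange ⟨l, hl⟩
    refine hg.1.2 r r.2 fun l => ?_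
    by_cases hl : g l = 0
    · rw [hl]; exact (hx.1 r l).1
    · exact hall ⟨l, by simpa using hl⟩
  · rintro ⟨k, rfl⟩ l hl
    exact he2 k l fun h => hl (by rw [Subtype.ext h])

lemma GeneralPosition.injective_corner (hx : GeneralPosition x n) :
    Function.Injective
      fun p : (T : Finset (Fin d)) × (T ↪ Fin n) => corner x p.1 p.2 := by
  have hmem : ∀ (T : Finset (Fin d)) (e : T ↪ Fin n) (l : Fin d), l ∈ T ↔ corner x T e l ≠ 0 := by
    intro T e l
    by_cases hl : l ∈ T
    · simpa [hl, corner_of_mem e ⟨l, hl⟩] using (hx.1 (e ⟨l, hl⟩) l).1.ne'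
    · simp [hl, corner_of_notMem e hl]
  rintro ⟨T, e⟩ ⟨T', e'⟩ h
  have h : corner x T e = corner x T' e' := h
  obtain rfl : T = T' := by
    ext l; rw [hmem T e, hmem T' e', h]
  congr 1
  ext l : 1
  refine hx.2 l ?_
  have := congrFun h l
  rwa [corner_of_mem, corner_of_mem] at this

/-- In general position the generators correspond bijectively to the pairs `(T, e)`, where `T` is
the set of positive coordinates and `e` tells which observation provides each of them. -/
theorem GeneralPosition.ncard_generators (hx : GeneralPosition x n) :
    ((generators x n).ncard : ℝ) =
      ∑ T : Finset (Fin d), ∑ e : T ↪ Fin n, {x | IsSupport x T e}.indicator 1 x := by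
  classical
  have himage : generators x n =
      (fun p : (T : Finset (Fin d)) × (T ↪ Fin n) => corner x p.1 p.2) ''
        (Finset.univ.filter fun p : (T : Finset (Fin d)) × (T ↪ Fin n) => IsSupport x p.1 p.2) := by
    ext g
    constructor
    · intro hg
      obtain ⟨T, e, he, rfl⟩ := hx.exists_isSupport hg
      exact ⟨⟨T, e⟩, by simpa using he, rfl⟩
    · rintro ⟨⟨T, e⟩, he, rfl⟩
      exact hx.corner_mem_generators (by simpa using he)
  rw [himage, Set.ncard_image_of_injective _ hx.injective_corner, Set.ncard_coe_finset,
    Finset.card_filter, ← Finset.univ_sigma_univ, Finset.sum_sigma]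
  push_cast
  simp [Set.indicator_apply]

end Combinatorics

/-! ### Derivatives of the Gamma function -/

/-- The measure `e⁻ᵗ t⁻¹ dt` on `(0, ∞)`, whose Mellin transform is the Gamma function. -/
noncomputable def gammaKernel : Measure ℝ :=
  (volume.restrict (Set.Ioi 0)).withDensity fun t => ENNReal.ofReal (Real.exp (-t) * t⁻¹)

lemma measurable_gammaKernel_density :
    Measurable fun t : ℝ => (Real.exp (-t) * t⁻¹).toNNReal := by fun_prop

lemma exp_mul_inv_smul_log (s : ℝ) (f : ℝ → ℝ) {t : ℝ} (ht : t ∈ Set.Ioi (0 : ℝ)) :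
    (Real.exp (-t) * t⁻¹).toNNReal • (f t * Real.exp (s * Real.log t)) =
      Real.exp (-t) * t ^ (s - 1) * f t := by
  have ht : 0 < t := ht
  rw [NNReal.smul_def, Real.coe_toNNReal _ (by positivity), smul_eq_mul,
    show s * Real.log t = Real.log t * s by ring, ← Real.rpow_def_of_pos ht,
    Real.rpow_sub_one ht.ne']
  field_simp

lemma integral_gammaKernel (s : ℝ) (f : ℝ → ℝ) :
    ∫ t, f t * Real.exp (s * Real.log t) ∂gammaKernel =
      ∫ t in Set.Ioi (0 : ℝ), Real.exp (-t) * t ^ (s - 1) * f t := by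
  rw [gammaKernel]
  refine (integral_withDensity_eq_integral_smul measurable_gammaKernel_density _).trans ?_
  exact setIntegral_congr_fun measurableSet_Ioi fun t ht => exp_mul_inv_smul_log s f ht

lemma integrable_gammaKernel_iff (s : ℝ) (f : ℝ → ℝ) :
    Integrable (fun t => f t * Real.exp (s * Real.log t)) gammaKernel ↔
      IntegrableOn (fun t => Real.exp (-t) * t ^ (s - 1) * f t) (Set.Ioi (0 : ℝ)) := by
  rw [gammaKernel]
  refine (integrable_withDensity_iff_integrable_smul measurable_gammaKernel_density).trans ?_
  exact integrableOn_congr_fun (fun t ht => exp_mul_inv_smul_log s f ht) measurableSet_Ioi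

lemma mem_interior_integrableExpSet_gammaKernel {s : ℝ} (hs : 0 < s) :
    s ∈ interior (integrableExpSet Real.log gammaKernel) := by
  refine mem_interior.2 ⟨Set.Ioi 0, fun r hr => ?_, isOpen_Ioi, hs⟩
  have := (integrable_gammaKernel_iff r fun _ => 1).2
    (by simpa using Real.GammaIntegral_convergent hr)
  simpa [integrableExpSet] using this

/-- Differentiation under the integral sign in Euler's integral, obtained from the derivatives of
the moment generating function of `log` under `gammaKernel`. -/
theorem iteratedDeriv_Gamma {s : ℝ} (hs : 0 < s) (k : ℕ) :
    iteratedDeriv k Real.Gamma s =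
      ∫ t in Set.Ioi (0 : ℝ), Real.exp (-t) * t ^ (s - 1) * Real.log t ^ k := by
  have hev : Real.Gamma =ᶠ[nhds s] mgf Real.log gammaKernel := by
    filter_upwards [lt_mem_nhds hs] with r hr
    have := integral_gammaKernel r fun _ => 1
    simp only [one_mul, mul_one] at this
    rw [Real.Gamma_eq_integral hr, mgf, this]
  rw [hev.iteratedDeriv_eq k,
    iteratedDeriv_mgf (mem_interior_integrableExpSet_gammaKernel hs) k]
  exact integral_gammaKernel s fun t => Real.log t ^ k

lemma integrableOn_exp_neg_mul_rpow_mul_log_pow {s : ℝ} (hs : 0 < s) (k : ℕ) :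
    IntegrableOn (fun t => Real.exp (-t) * t ^ (s - 1) * Real.log t ^ k) (Set.Ioi (0 : ℝ)) :=
  (integrable_gammaKernel_iff s _).1 <| integrable_pow_mul_exp_of_mem_interior_integrableExpSet
    (mem_interior_integrableExpSet_gammaKernel hs) k

lemma integrableOn_exp_neg_mul_pow_mul_log_pow (a k : ℕ) :
    IntegrableOn (fun t => Real.exp (-t) * t ^ a * Real.log t ^ k) (Set.Ioi (0 : ℝ)) := by
  simpa using integrableOn_exp_neg_mul_rpow_mul_log_pow (s := a + 1) (by positivity) k

lemma iteratedDeriv_Gamma_natCast_succ (a k : ℕ) :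
    iteratedDeriv k Real.Gamma ((a + 1 : ℕ) : ℝ) =
      ∫ t in Set.Ioi (0 : ℝ), Real.exp (-t) * t ^ a * Real.log t ^ k := by
  rw [iteratedDeriv_Gamma (by positivity)]
  simp

/-! ### Asymptotics of the logarithmic Beta integral -/

/-- The integral `∫₀¹ pᵃ (1 - p)ⁿ⁻ᵃ⁻¹ (-log p)ᵃ dp`, which is `a!` times the probability that
`a + 1` given observations out of `n` support a generator with `a + 1` given positive
coordinates. -/
noncomputable def logBeta (a n : ℕ) : ℝ :=
  ∫ p in Set.Ioo (0 : ℝ) 1, p ^ a * (1 - p) ^ (n - (a + 1)) * (-Real.log p) ^ a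

/-- The polynomial in `L = log n` to which `nᵃ⁺¹ * logBeta a n` is asymptotic. -/
noncomputable def logPoly (a : ℕ) (L : ℝ) : ℝ :=
  ∑ k ∈ Finset.range (a + 1),
    (a.choose k : ℝ) * ((-1) ^ k * iteratedDeriv k Real.Gamma ((a + 1 : ℕ) : ℝ)) * L ^ (a - k)

/-- The function equal to `(1 - t / n) ^ (n - m)` for `t < n` and to `0` for `t ≥ n`. -/
noncomputable def truncPow (m n : ℕ) (t : ℝ) : ℝ :=
  (Set.Iio (n : ℝ)).indicator (fun t => (1 - t / n) ^ (n - m)) t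

lemma measurable_truncPow (m n : ℕ) : Measurable (truncPow m n) :=
  Measurable.indicator (by fun_prop) measurableSet_Iio

/-- The power `(1 - t / n) ^ (n - m)` is within a relative error `O((t ^ 2 + t) / n)` of
`exp (-t)`. -/
lemma abs_truncPow_sub_exp_le {m n : ℕ} (hmn : m ≤ n) (hn : 0 < n) {t : ℝ} (ht : 0 < t) :
    |truncPow m n t - Real.exp (-t)| ≤
      Real.exp (-t) * (t ^ 2 + (m * Real.exp m + 1) * t) / n := by
  have hn' : (0 : ℝ) < n := by exact_mod_cast hn
  have hE := Real.exp_pos (-t)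
  have hM : 0 ≤ m * Real.exp m := by positivity
  by_cases htn : t < n
  · rw [truncPow, Set.indicator_of_mem (show t ∈ Set.Iio (n : ℝ) from htn)]
    set p := t / n with hp
    have hp0 : 0 < p := by positivity
    have hp1 : p < 1 := (div_lt_one hn').2 htn
    have htp : t = n * p := by rw [hp]; field_simp
    have hupper : (1 - p) ^ (n - m) ≤ Real.exp (-t) * (1 + m * Real.exp m * p) := by
      calc (1 - p) ^ (n - m) ≤ Real.exp (-p) ^ (n - m) :=
            pow_le_pow_left₀ (by linarith) (by linarith [Real.add_one_le_exp (-p)]) _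
        _ = Real.exp (-t) * Real.exp (m * p) := by
            rw [← Real.exp_nat_mul, ← Real.exp_add, Nat.cast_sub hmn, htp]; ring_nf
        _ ≤ Real.exp (-t) * (1 + m * Real.exp m * p) := by
            refine mul_le_mul_of_nonneg_left ?_ hE.le
            have h1 : 1 - m * p ≤ Real.exp (-(m * p)) := by
              linarith [Real.add_one_le_exp (-(m * p))]
            have h2 : Real.exp (m * p) * (1 - m * p) ≤ 1 := by
              calc _ ≤ Real.exp (m * p) * Real.exp (-(m * p)) :=
                    mul_le_mul_of_nonneg_left h1 (Real.exp_pos _).le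
                _ = 1 := by rw [← Real.exp_add]; simp
            have h3 : Real.exp (m * p) ≤ Real.exp m :=
              Real.exp_le_exp.2 (mul_le_of_le_one_right (Nat.cast_nonneg m) hp1.le)
            have h4 := mul_le_mul_of_nonneg_right h3 (show (0 : ℝ) ≤ m * p by positivity)
            nlinarith
    -- `1 - p ≥ exp (-p) * (1 - p ^ 2)`, followed by Bernoulli's inequality
    have hlower : Real.exp (-t) * (1 - n * p ^ 2) ≤ (1 - p) ^ (n - m) := by
      have hbase : Real.exp (-p) * (1 - p ^ 2) ≤ 1 - p := by
        have h1 : Real.exp (-p) * (1 + p) ≤ 1 := by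
          calc _ ≤ Real.exp (-p) * Real.exp p :=
                mul_le_mul_of_nonneg_left (by linarith [Real.add_one_le_exp p])
                  (Real.exp_pos _).le
            _ = 1 := by rw [← Real.exp_add]; simp
        nlinarith
      have hp2 : p ^ 2 ≤ 1 := by nlinarith
      calc Real.exp (-t) * (1 - n * p ^ 2) ≤ Real.exp (-t) * (1 - p ^ 2) ^ n := by
            refine mul_le_mul_of_nonneg_left ?_ hE.le
            have := one_add_mul_le_pow (a := -p ^ 2) (by linarith) n
            rw [← sub_eq_add_neg] at this
            linarith
        _ = (Real.exp (-p) * (1 - p ^ 2)) ^ n := by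
            rw [mul_pow, ← Real.exp_nat_mul, htp]; ring_nf
        _ ≤ (1 - p) ^ n :=
            pow_le_pow_left₀ (mul_nonneg (Real.exp_pos _).le (by linarith)) hbase n
        _ ≤ (1 - p) ^ (n - m) :=
            pow_le_pow_of_le_one (by linarith) (by linarith) (Nat.sub_le n m)
    have hrhs : Real.exp (-t) * (t ^ 2 + (m * Real.exp m + 1) * t) / n =
        Real.exp (-t) * (n * p ^ 2 + (m * Real.exp m + 1) * p) := by
      rw [htp]; field_simp
    rw [hrhs, abs_le]
    have h1 : 0 ≤ Real.exp (-t) * (m * Real.exp m * p) := by positivity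
    have h2 : 0 ≤ Real.exp (-t) * p := by positivity
    have h3 : 0 ≤ Real.exp (-t) * (n * p ^ 2) := by positivity
    constructor <;> nlinarith
  · rw [truncPow, Set.indicator_of_notMem (by simpa using htn), zero_sub, abs_neg,
      abs_of_pos hE, mul_div_assoc]
    refine le_mul_of_one_le_right hE.le ((one_le_div hn').2 ?_)
    nlinarith [not_lt.1 htn, sq_nonneg t]

lemma integrableOn_exp_neg_mul_pow_mul_one_add_abs_log_pow (b a : ℕ) :
    IntegrableOn (fun t => Real.exp (-t) * t ^ b * (1 + |Real.log t|) ^ a) (Set.Ioi (0 : ℝ)) := by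
  have hsum : (fun t => Real.exp (-t) * t ^ b * (1 + |Real.log t|) ^ a) = fun t =>
      ∑ k ∈ Finset.range (a + 1),
        (a.choose k : ℝ) * (Real.exp (-t) * t ^ b * |Real.log t| ^ k) := by
    funext t
    rw [add_comm, add_pow, Finset.mul_sum]
    exact Finset.sum_congr rfl fun k _ => by simp; ring
  rw [hsum]
  refine integrable_finsetSum _ fun k _ => Integrable.const_mul ?_ _
  refine (integrableOn_congr_fun (fun t ht => ?_) measurableSet_Ioi).1
    (integrableOn_exp_neg_mul_pow_mul_log_pow b k).norm
  have ht : 0 < t := ht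
  simp [abs_of_pos ht]

lemma integral_exp_neg_mul_pow_mul_sub_log_pow (a : ℕ) (L : ℝ) :
    IntegrableOn (fun t => Real.exp (-t) * t ^ a * (L - Real.log t) ^ a) (Set.Ioi (0 : ℝ)) ∧
      ∫ t in Set.Ioi (0 : ℝ), Real.exp (-t) * t ^ a * (L - Real.log t) ^ a = logPoly a L := by
  have hsum : (fun t => Real.exp (-t) * t ^ a * (L - Real.log t) ^ a) = fun t =>
      ∑ k ∈ Finset.range (a + 1), ((a.choose k : ℝ) * (-1) ^ k * L ^ (a - k)) *
        (Real.exp (-t) * t ^ a * Real.log t ^ k) := by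
    funext t
    rw [sub_eq_neg_add, add_pow, Finset.mul_sum]
    refine Finset.sum_congr rfl fun k _ => ?_
    rw [neg_pow]; ring
  have hint : ∀ k ∈ Finset.range (a + 1),
      IntegrableOn (fun t => ((a.choose k : ℝ) * (-1) ^ k * L ^ (a - k)) *
        (Real.exp (-t) * t ^ a * Real.log t ^ k)) (Set.Ioi (0 : ℝ)) := fun k _ =>
    (integrableOn_exp_neg_mul_pow_mul_log_pow a k).const_mul _
  rw [hsum]
  refine ⟨integrable_finsetSum _ hint, ?_⟩
  rw [integral_finsetSum _ hint, logPoly]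
  refine Finset.sum_congr rfl fun k _ => ?_
  rw [integral_const_mul, ← iteratedDeriv_Gamma_natCast_succ]
  ring

/-- The substitution `p = t / n`. -/
lemma pow_mul_logBeta (a : ℕ) {n : ℕ} (hn : 0 < n) :
    (n : ℝ) ^ (a + 1) * logBeta a n =
      ∫ t in Set.Ioi (0 : ℝ), truncPow (a + 1) n t * t ^ a * (Real.log n - Real.log t) ^ a := by
  have hn' : (0 : ℝ) < n := by exact_mod_cast hn
  have h1 : logBeta a n =
      ∫ p in (0 : ℝ)..1, p ^ a * (1 - p) ^ (n - (a + 1)) * (-Real.log p) ^ a := by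
    rw [intervalIntegral.integral_of_le zero_le_one, integral_Ioc_eq_integral_Ioo, logBeta]
  have h2 := intervalIntegral.integral_comp_div (a := 0) (b := (n : ℝ))
    (fun p : ℝ => p ^ a * (1 - p) ^ (n - (a + 1)) * (-Real.log p) ^ a) hn'.ne'
  rw [zero_div, div_self hn'.ne', ← h1, smul_eq_mul,
    intervalIntegral.integral_of_le hn'.le, integral_Ioc_eq_integral_Ioo] at h2
  rw [pow_succ, mul_assoc, ← h2, ← integral_const_mul]
  have h3 : ∀ t ∈ Set.Ioi (0 : ℝ),
      truncPow (a + 1) n t * t ^ a * (Real.log n - Real.log t) ^ a =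
      (Set.Iio (n : ℝ)).indicator (fun t => (n : ℝ) ^ a * ((t / n) ^ a *
        (1 - t / n) ^ (n - (a + 1)) * (-Real.log (t / n)) ^ a)) t := by
    intro t ht
    have ht : 0 < t := ht
    by_cases htn : t ∈ Set.Iio (n : ℝ)
    · rw [truncPow, Set.indicator_of_mem htn, Set.indicator_of_mem htn,
        Real.log_div ht.ne' hn'.ne', neg_sub, div_pow]
      field_simp
    · rw [truncPow, Set.indicator_of_notMem htn, Set.indicator_of_notMem htn]
      simp
  rw [setIntegral_congr_fun measurableSet_Ioi h3, setIntegral_indicator measurableSet_Iio,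
    Set.Ioi_inter_Iio]

/-- The expansion of the integral `logBeta`, before the falling factorial is taken into
account. -/
lemma exists_abs_pow_mul_logBeta_sub_logPoly_le (a : ℕ) :
    ∃ C : ℝ, ∀ n : ℕ, a + 1 ≤ n → 1 ≤ Real.log n →
      |(n : ℝ) ^ (a + 1) * logBeta a n - logPoly a (Real.log n)| ≤
        C * ((n : ℝ)⁻¹ * Real.log n ^ a) := by
  set M : ℝ := ((a + 1 : ℕ) : ℝ) * Real.exp ((a + 1 : ℕ) : ℝ) + 1 with hM
  have hM0 : 0 ≤ M := by positivity
  set G : ℝ → ℝ := fun t => Real.exp (-t) * t ^ (a + 2) * (1 + |Real.log t|) ^ a +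
    M * (Real.exp (-t) * t ^ (a + 1) * (1 + |Real.log t|) ^ a) with hG
  have hGint : IntegrableOn G (Set.Ioi 0) :=
    (integrableOn_exp_neg_mul_pow_mul_one_add_abs_log_pow (a + 2) a).add
      ((integrableOn_exp_neg_mul_pow_mul_one_add_abs_log_pow (a + 1) a).const_mul M)
  refine ⟨∫ t in Set.Ioi (0 : ℝ), G t, fun n hn hL => ?_⟩
  have hn0 : 0 < n := by omega
  have hn' : (0 : ℝ) < n := by exact_mod_cast hn0
  set L := Real.log n
  obtain ⟨hEint, hEeq⟩ := integral_exp_neg_mul_pow_mul_sub_log_pow a L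
  set F : ℝ → ℝ := fun t => truncPow (a + 1) n t * t ^ a * (L - Real.log t) ^ a
  set E : ℝ → ℝ := fun t => Real.exp (-t) * t ^ a * (L - Real.log t) ^ a
  have hbound : ∀ t ∈ Set.Ioi (0 : ℝ), ‖F t - E t‖ ≤ ((n : ℝ)⁻¹ * L ^ a) * G t := by
    intro t ht
    have ht : 0 < t := ht
    have h1 := abs_truncPow_sub_exp_le hn hn0 ht
    rw [← hM] at h1
    have h2 : |L - Real.log t| ≤ L * (1 + |Real.log t|) := by
      calc |L - Real.log t| ≤ |L| + |Real.log t| := abs_sub _ _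
        _ ≤ L * (1 + |Real.log t|) := by
          rw [abs_of_nonneg (by linarith)]
          nlinarith [abs_nonneg (Real.log t)]
    have h3 : F t - E t =
        (truncPow (a + 1) n t - Real.exp (-t)) * t ^ a * (L - Real.log t) ^ a := by
      simp only [F, E]; ring
    rw [h3, Real.norm_eq_abs, abs_mul, abs_mul, abs_pow, abs_pow, abs_of_pos ht]
    calc _ ≤ (Real.exp (-t) * (t ^ 2 + M * t) / n) * t ^ a * (L * (1 + |Real.log t|)) ^ a := by
          gcongr
      _ = ((n : ℝ)⁻¹ * L ^ a) * G t := by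
          simp only [hG]; rw [mul_pow]; field_simp; ring
  have hdiff : IntegrableOn (fun t => F t - E t) (Set.Ioi 0) := by
    refine Integrable.mono' (hGint.const_mul ((n : ℝ)⁻¹ * L ^ a)) ?_
      ((ae_restrict_iff' measurableSet_Ioi).2 (Eventually.of_forall hbound))
    have := measurable_truncPow (a + 1) n
    exact Measurable.aestronglyMeasurable (by fun_prop)
  have hFint : IntegrableOn F (Set.Ioi 0) := by
    have hFE : (fun t => F t - E t) + E = F := by ext t; simp
    exact hFE ▸ hdiff.add hEint
  rw [pow_mul_logBeta a hn0, ← hEeq, ← integral_sub hFint hEint, mul_comm,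
    ← integral_const_mul, ← Real.norm_eq_abs]
  exact norm_integral_le_of_norm_le (hGint.const_mul _)
    ((ae_restrict_iff' measurableSet_Ioi).2 (Eventually.of_forall hbound))

lemma eventually_one_le_log_natCast : ∀ᶠ n : ℕ in atTop, 1 ≤ Real.log n :=
  (Real.tendsto_log_atTop.comp tendsto_natCast_atTop_atTop).eventually_ge_atTop 1

lemma pow_mul_logBeta_sub_logPoly_isBigO (a : ℕ) :
    (fun n : ℕ => (n : ℝ) ^ (a + 1) * logBeta a n - logPoly a (Real.log n)) =O[atTop]
      fun n : ℕ => (n : ℝ)⁻¹ * Real.log n ^ a := by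
  obtain ⟨C, hC⟩ := exists_abs_pow_mul_logBeta_sub_logPoly_le a
  refine IsBigO.of_bound C ?_
  filter_upwards [eventually_ge_atTop (a + 1), eventually_one_le_log_natCast] with n hn hL
  rw [Real.norm_eq_abs, Real.norm_of_nonneg (by positivity)]
  exact hC n hn hL

lemma log_pow_isBigO_log_pow {a b : ℕ} (hab : a ≤ b) :
    (fun n : ℕ => Real.log n ^ a) =O[atTop] fun n : ℕ => Real.log n ^ b := by
  refine IsBigO.of_bound 1 ?_
  filter_upwards [eventually_one_le_log_natCast] with n hL
  rw [Real.norm_of_nonneg (by positivity), Real.norm_of_nonneg (by positivity), one_mul]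
  exact pow_le_pow_right₀ hL hab

lemma logPoly_isBigO (a : ℕ) :
    (fun n : ℕ => logPoly a (Real.log n)) =O[atTop] fun n : ℕ => Real.log n ^ a := by
  unfold logPoly
  refine IsBigO.fun_sum fun k _ => ?_
  exact (log_pow_isBigO_log_pow (Nat.sub_le a k)).const_mul_left _

lemma descFactorial_div_pow_sub_one_isBigO (m : ℕ) :
    (fun n : ℕ => (n.descFactorial m : ℝ) / (n : ℝ) ^ m - 1) =O[atTop] fun n : ℕ => (n : ℝ)⁻¹ := by
  refine IsBigO.of_bound ((m : ℝ) * m) ?_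
  filter_upwards [eventually_ge_atTop (m + 1)] with n hn
  have hn' : (0 : ℝ) < n := by exact_mod_cast (by omega : 0 < n)
  have hmn : (m : ℝ) ≤ n := by exact_mod_cast (by omega : m ≤ n)
  have hupper : (n.descFactorial m : ℝ) / (n : ℝ) ^ m ≤ 1 := by
    rw [div_le_one (by positivity)]
    exact_mod_cast Nat.descFactorial_le_pow n m
  have hlower : 1 - (m : ℝ) * m * (n : ℝ)⁻¹ ≤ (n.descFactorial m : ℝ) / (n : ℝ) ^ m := by
    have h1 : ((n - m : ℕ) : ℝ) ^ m ≤ n.descFactorial m := by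
      exact_mod_cast (Nat.pow_le_pow_left (by omega) m).trans (Nat.pow_sub_le_descFactorial n m)
    rw [Nat.cast_sub (by omega)] at h1
    calc 1 - (m : ℝ) * m * (n : ℝ)⁻¹ = 1 + m * (-(m / n)) := by field_simp; ring
      _ ≤ (1 + -(m / n : ℝ)) ^ m := by
          refine one_add_mul_le_pow ?_ m
          have : (m : ℝ) / n ≤ 1 := (div_le_one hn').2 hmn
          linarith
      _ = ((n : ℝ) - m) ^ m / (n : ℝ) ^ m := by rw [← div_pow]; congr 1; field_simp; ring
      _ ≤ _ := by gcongr
  rw [Real.norm_eq_abs, abs_le, Real.norm_of_nonneg (by positivity)]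
  constructor
  · linarith
  · have : 0 ≤ (m : ℝ) * m * (n : ℝ)⁻¹ := by positivity
    linarith

theorem descFactorial_mul_logBeta_sub_logPoly_isBigO (a : ℕ) :
    (fun n : ℕ => (n.descFactorial (a + 1) : ℝ) * logBeta a n - logPoly a (Real.log n)) =O[atTop]
      fun n : ℕ => (n : ℝ)⁻¹ * Real.log n ^ a := by
  have h := pow_mul_logBeta_sub_logPoly_isBigO a
  have hinv : (fun n : ℕ => (n : ℝ)⁻¹ * Real.log n ^ a) =O[atTop]
      fun n : ℕ => Real.log n ^ a := by
    refine IsBigO.of_bound 1 ?_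
    filter_upwards [eventually_ge_atTop 1] with n hn
    rw [norm_mul, Real.norm_of_nonneg (by positivity : (0 : ℝ) ≤ (n : ℝ)⁻¹)]
    gcongr
    exact inv_le_one_of_one_le₀ (by exact_mod_cast hn)
  have hsize : (fun n : ℕ => (n : ℝ) ^ (a + 1) * logBeta a n) =O[atTop]
      fun n : ℕ => Real.log n ^ a := by
    simpa using (h.trans hinv).add (logPoly_isBigO a)
  refine (((descFactorial_div_pow_sub_one_isBigO (a + 1)).mul hsize).add h).congr' ?_ .rfl
  filter_upwards [eventually_ge_atTop 1] with n hn
  have hn' : (n : ℝ) ≠ 0 := by positivity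
  field_simp
  ring

/-! ### Products of independent uniform variables -/

/-- The law on `(0, 1)` of the product of `a + 1` independent uniform variables, with density
`(-log p)ᵃ / a!`. -/
noncomputable def uniformProdLaw (a : ℕ) : Measure ℝ :=
  (volume.restrict (Set.Ioo 0 1)).withDensity
    fun p => ENNReal.ofReal ((-Real.log p) ^ a / (a ! : ℝ))

lemma lintegral_uniformProdLaw (a : ℕ) {f : ℝ → ℝ≥0∞} (hf : Measurable f) :
    ∫⁻ p, f p ∂uniformProdLaw a =
      ∫⁻ p in Set.Ioo 0 1, ENNReal.ofReal ((-Real.log p) ^ a / (a ! : ℝ)) * f p := by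
  rw [uniformProdLaw, lintegral_withDensity_eq_lintegral_mul _ (by fun_prop) hf]
  rfl

/-- The substitution `q = u * p` in the uniform variable `u`. -/
lemma lintegral_Ioo_comp_mul {p : ℝ} (hp : 0 < p) (f : ℝ → ℝ≥0∞) (hf : Measurable f) :
    ∫⁻ u in Set.Ioo (0 : ℝ) 1, f (u * p) =
      ENNReal.ofReal p⁻¹ * ∫⁻ q in Set.Ioo 0 p, f q := by
  have hmap := Real.map_volume_mul_right hp.ne'
  rw [abs_of_pos (inv_pos.2 hp)] at hmap
  have hpre : ∀ u, (Set.Ioo (0 : ℝ) 1).indicator (fun u => f (u * p)) u =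
      (Set.Ioo 0 p).indicator f (u * p) := by
    intro u
    by_cases hu : u ∈ Set.Ioo (0 : ℝ) 1
    · rw [Set.indicator_of_mem hu, Set.indicator_of_mem]
      exact ⟨mul_pos hu.1 hp, by nlinarith [hu.2]⟩
    · rw [Set.indicator_of_notMem hu, Set.indicator_of_notMem]
      exact fun h => hu ⟨pos_of_mul_pos_left h.1 hp.le, by nlinarith [h.2]⟩
  rw [← lintegral_indicator measurableSet_Ioo, ← lintegral_indicator measurableSet_Ioo]
  simp_rw [hpre]
  rw [← lintegral_map (f := (Set.Ioo 0 p).indicator f) (hf.indicator measurableSet_Ioo)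
    (by fun_prop), hmap, lintegral_smul_measure, smul_eq_mul]

lemma lintegral_log_pow_div (a : ℕ) {q : ℝ} (hq : q ∈ Set.Ioo (0 : ℝ) 1) :
    ∫⁻ p in Set.Ioo q 1, ENNReal.ofReal ((-Real.log p) ^ a / (a ! : ℝ)) * ENNReal.ofReal p⁻¹ =
      ENNReal.ofReal ((-Real.log q) ^ (a + 1) / ((a + 1)! : ℝ)) := by
  have hcont : ContinuousOn (fun p : ℝ => (-Real.log p) ^ a / (a ! : ℝ) * p⁻¹)
      (Set.uIcc q 1) := by
    rw [Set.uIcc_of_le hq.2.le]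
    have h0 : ∀ p ∈ Set.Icc q 1, p ≠ 0 := fun p hp => (hq.1.trans_le hp.1).ne'
    fun_prop (disch := assumption)
  have hint := hcont.intervalIntegrable (μ := volume)
  have hFTC : ∫ p in q..1, (-Real.log p) ^ a / (a ! : ℝ) * p⁻¹ =
      (-Real.log q) ^ (a + 1) / ((a + 1)! : ℝ) := by
    rw [intervalIntegral.integral_eq_sub_of_hasDerivAt
      (f := fun p => -((-Real.log p) ^ (a + 1) / ((a + 1)! : ℝ))) _ hint]
    · simp
    · intro p hp
      rw [Set.uIcc_of_le hq.2.le] at hp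
      have hp0 : p ≠ 0 := (hq.1.trans_le hp.1).ne'
      have := ((((Real.hasDerivAt_log hp0).fun_neg).fun_pow (a + 1)).div_const
        ((a + 1)! : ℝ)).fun_neg
      convert this using 1
      rw [Nat.factorial_succ]
      push_cast
      field_simp
  rw [← hFTC, intervalIntegral.integral_of_le hq.2.le, integral_Ioc_eq_integral_Ioo,
    ofReal_integral_eq_lintegral_ofReal]
  · refine setLIntegral_congr_fun measurableSet_Ioo fun p hp => ?_
    have hp0 : 0 < p := hq.1.trans hp.1
    exact (ENNReal.ofReal_mul' (inv_nonneg.2 hp0.le)).symm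
  · rw [intervalIntegrable_iff_integrableOn_Ioo_of_le hq.2.le] at hint
    exact hint
  · refine (ae_restrict_iff' measurableSet_Ioo).2 (Eventually.of_forall fun p hp => ?_)
    have hp0 : 0 < p := hq.1.trans hp.1
    have := Real.log_nonpos hp0.le hp.2.le
    have h2 : 0 ≤ -Real.log p := by linarith
    positivity

/-- Multiplying by one more independent uniform variable. -/
lemma lintegral_lintegral_mul_uniformProdLaw (a : ℕ) {f : ℝ → ℝ≥0∞} (hf : Measurable f) :
    ∫⁻ p, (∫⁻ u in Set.Ioo (0 : ℝ) 1, f (u * p)) ∂uniformProdLaw a =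
      ∫⁻ q, f q ∂uniformProdLaw (a + 1) := by
  have hmeas : Measurable fun p => ∫⁻ u in Set.Ioo (0 : ℝ) 1, f (u * p) :=
    Measurable.lintegral_prod_right' (f := fun z : ℝ × ℝ => f (z.2 * z.1)) (by fun_prop)
  set D : ℝ → ℝ≥0∞ := fun p =>
    ENNReal.ofReal ((-Real.log p) ^ a / (a ! : ℝ)) * ENNReal.ofReal p⁻¹ with hD
  have hDm : Measurable D := by fun_prop
  -- the region `0 < q < p < 1`
  set R : Set (ℝ × ℝ) := {z | 0 < z.2 ∧ z.2 < z.1 ∧ z.1 < 1} with hR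
  have hRm : MeasurableSet R := by
    refine (measurableSet_lt measurable_const measurable_snd).inter
      ((measurableSet_lt measurable_snd measurable_fst).inter
        (measurableSet_lt measurable_fst measurable_const))
  set K : ℝ × ℝ → ℝ≥0∞ := R.indicator fun z => D z.1 * f z.2 with hK
  have hKm : Measurable K := Measurable.indicator (by fun_prop) hRm
  calc
    _ = ∫⁻ p in Set.Ioo (0 : ℝ) 1, D p * ∫⁻ q in Set.Ioo 0 p, f q := by
      rw [lintegral_uniformProdLaw a hmeas]
      refine setLIntegral_congr_fun measurableSet_Ioo fun p hp => ?_
      simp only [hD]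
      rw [lintegral_Ioo_comp_mul hp.1 f hf, mul_assoc]
    _ = ∫⁻ p, ∫⁻ q, K (p, q) := by
      rw [← lintegral_indicator measurableSet_Ioo]
      refine lintegral_congr fun p => ?_
      by_cases hp : p ∈ Set.Ioo (0 : ℝ) 1
      · rw [Set.indicator_of_mem hp, ← lintegral_const_mul _ hf,
          ← lintegral_indicator measurableSet_Ioo]
        refine lintegral_congr fun q => ?_
        by_cases hq : q ∈ Set.Ioo 0 p
        · rw [Set.indicator_of_mem hq, hK, Set.indicator_of_mem]
          exact ⟨hq.1, hq.2, hp.2⟩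
        · rw [Set.indicator_of_notMem hq, hK, Set.indicator_of_notMem]
          exact fun h => hq ⟨h.1, h.2.1⟩
      · rw [Set.indicator_of_notMem hp]
        symm
        refine (lintegral_congr fun q => ?_).trans lintegral_zero
        rw [hK, Set.indicator_of_notMem]
        exact fun h => hp ⟨h.1.trans h.2.1, h.2.2⟩
    _ = ∫⁻ q, ∫⁻ p, K (p, q) := lintegral_lintegral_swap hKm.aemeasurable
    _ = ∫⁻ q in Set.Ioo (0 : ℝ) 1, (∫⁻ p in Set.Ioo q 1, D p) * f q := by
      rw [← lintegral_indicator measurableSet_Ioo]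
      refine lintegral_congr fun q => ?_
      by_cases hq : q ∈ Set.Ioo (0 : ℝ) 1
      · rw [Set.indicator_of_mem hq, ← lintegral_mul_const _ hDm,
          ← lintegral_indicator measurableSet_Ioo]
        refine lintegral_congr fun p => ?_
        by_cases hp : p ∈ Set.Ioo q 1
        · rw [Set.indicator_of_mem hp, hK, Set.indicator_of_mem]
          exact ⟨hq.1, hp.1, hp.2⟩
        · rw [Set.indicator_of_notMem hp, hK, Set.indicator_of_notMem]
          exact fun h => hp ⟨h.2.1, h.2.2⟩
      · rw [Set.indicator_of_notMem hq]
        refine (lintegral_congr fun p => ?_).trans lintegral_zero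
        rw [hK, Set.indicator_of_notMem]
        exact fun h => hq ⟨h.1, h.2.1.trans h.2.2⟩
    _ = _ := by
      rw [lintegral_uniformProdLaw (a + 1) hf]
      refine setLIntegral_congr_fun measurableSet_Ioo fun q hq => ?_
      rw [← lintegral_log_pow_div a hq]

/-- The law of a product of finitely many independent uniform variables. -/
theorem map_prod_eq_uniformProdLaw {Ω ι : Type*} [MeasurableSpace Ω] {P : Measure Ω}
    [IsProbabilityMeasure P] {U : ι → Ω → ℝ} (hU : ∀ i, Measurable (U i)) (hind : iIndepFun U P)
    (hlaw : ∀ i, P.map (U i) = volume.restrict (Set.Ioo 0 1)) (s : Finset ι) (a : ℕ)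
    (hs : s.card = a + 1) :
    P.map (fun ω => ∏ i ∈ s, U i ω) = uniformProdLaw a := by
  classical
  induction a generalizing s with
  | zero =>
    obtain ⟨i, rfl⟩ := Finset.card_eq_one.1 hs
    simp [uniformProdLaw, hlaw]
  | succ a ih =>
    obtain ⟨i, s, hi, rfl, hcard⟩ := Finset.card_eq_succ.1 hs
    have hprod : Measurable fun ω => ∏ j ∈ s, U j ω := by fun_prop
    have hindep : IndepFun (fun ω => ∏ j ∈ s, U j ω) (U i) P := by
      have := hind.indepFun_finsetProd_of_notMem hU hi
      convert this using 1
      ext ω; simp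
    have hpair := hindep.map_prod_eq_prod_map_map hprod.aemeasurable (hU i).aemeasurable
    rw [ih s hcard, hlaw] at hpair
    refine Measure.ext_of_lintegral _ fun f hf => ?_
    rw [lintegral_map hf (by fun_prop), ← lintegral_lintegral_mul_uniformProdLaw a hf]
    have hprob : IsProbabilityMeasure (uniformProdLaw a) := by
      rw [← ih s hcard]; exact Measure.isProbabilityMeasure_map hprod.aemeasurable
    have hf' : Measurable fun z : ℝ × ℝ => f (z.2 * z.1) := by fun_prop
    rw [← lintegral_prod (fun z : ℝ × ℝ => f (z.2 * z.1)) hf'.aemeasurable, ← hpair,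
      lintegral_map hf' (by fun_prop)]
    simp [Finset.prod_insert hi]

/-! ### The exact expectation -/

section Probability

variable {Ω : Type*} [MeasurableSpace Ω] {P : Measure Ω}

/-- An event determined by two independent random elements has probability the average, over the
first one, of the probability with the first one frozen. -/
lemma measure_setOf_pair_mem [IsProbabilityMeasure P] {α β : Type*} [MeasurableSpace α]
    [MeasurableSpace β] {f : Ω → α} {g : Ω → β} (hf : Measurable f) (hg : Measurable g)
    (hfg : IndepFun f g P) {B : Set (α × β)}
    (hB : MeasurableSet B) :
    P {ω | (f ω, g ω) ∈ B} = ∫⁻ ω, P {ω' | (f ω, g ω') ∈ B} ∂P := by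
  have hpair := hfg.map_prod_eq_prod_map_map hf.aemeasurable hg.aemeasurable
  have hprob : IsProbabilityMeasure (P.map g) := Measure.isProbabilityMeasure_map hg.aemeasurable
  calc P {ω | (f ω, g ω) ∈ B} = P.map (fun ω => (f ω, g ω)) B :=
        (Measure.map_apply (hf.prodMk hg) hB).symm
    _ = ∫⁻ ω, P.map g (Prod.mk (f ω) ⁻¹' B) ∂P := by
        rw [hpair, Measure.prod_apply hB, lintegral_map (measurable_measure_prodMk_left hB) hf]
    _ = _ := lintegral_congr fun ω => Measure.map_apply hg (measurable_prodMk_left hB)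

lemma ae_ne_of_indepFun [IsProbabilityMeasure P] {f g : Ω → ℝ} (hf : Measurable f)
    (hg : Measurable g) (hfg : IndepFun f g P) [NullSingletonClass (P.map g)] :
    ∀ᵐ ω ∂P, f ω ≠ g ω := by
  have h := measure_setOf_pair_mem hf hg hfg (B := {z | z.1 = z.2})
    (measurableSet_eq_fun measurable_fst measurable_snd)
  have h0 : ∀ ω, P {ω' | (f ω, g ω') ∈ {z : ℝ × ℝ | z.1 = z.2}} = 0 := fun ω => by
    have := measure_singleton (μ := P.map g) (f ω)
    rw [Measure.map_apply hg (measurableSet_singleton _)] at this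
    refine (congrArg P ?_).trans this
    ext ω'
    simp [eq_comm]
  simp only [h0, lintegral_zero] at h
  rw [ae_iff]
  simpa using h

lemma map_eq_restrict_Ioo_of_isUniform {U : Ω → ℝ}
    (hU : pdf.IsUniform U (Set.Ico (0 : ℝ) 1) P volume) :
    P.map U = volume.restrict (Set.Ioo 0 1) := by
  rw [hU, ProbabilityTheory.cond, Measure.restrict_congr_set Ioo_ae_eq_Ico]
  simp

lemma map_one_sub_restrict_Ioo :
    (volume.restrict (Set.Ioo (0 : ℝ) 1)).map (fun x => 1 - x) =
      volume.restrict (Set.Ioo 0 1) := by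
  have h := (Measure.measurePreserving_sub_left (volume : Measure ℝ) 1).restrict_preimage
    (measurableSet_Ioo (a := (0 : ℝ)) (b := 1))
  have hpre : (fun x : ℝ => 1 - x) ⁻¹' Set.Ioo 0 1 = Set.Ioo 0 1 := by
    ext x; simp
  rw [hpre] at h
  exact h.map_eq

section Observations

variable {d : ℕ} {X : ℕ → Ω → Fin d → ℝ}

lemma measurable_corner (hX : ∀ i, Measurable (X i)) {n : ℕ} (T : Finset (Fin d))
    (e : T ↪ Fin n) : Measurable fun ω => corner (fun i => X i ω) T e := by
  refine measurable_pi_lambda _ fun l => ?_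
  by_cases hl : l ∈ T
  · simp only [corner, hl, dif_pos]
    exact (measurable_pi_apply l).comp (hX _)
  · simp [corner, hl]

lemma measurableSet_setOf_mem_rowSet {n : ℕ} (T : Finset (Fin d)) (e : T ↪ Fin n) (r : Fin n) :
    MeasurableSet {z : (Fin d → ℝ) × (Fin d → ℝ) | z.2 ∈ rowSet T e z.1 r} := by
  refine measurableSet_setOfPred.2 (Measurable.iff (Measurable.forall fun l => ?_) measurable_const)
  refine Measurable.imp measurable_const (measurableSet_setOfPred.1 (measurableSet_lt ?_ ?_)) <;>
    fun_prop

lemma measurableSet_isSupport (hX : ∀ i, Measurable (X i)) {n : ℕ} (T : Finset (Fin d))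
    (e : T ↪ Fin n) : MeasurableSet {ω | IsSupport (fun i => X i ω) T e} := by
  have : {ω | IsSupport (fun i => X i ω) T e} =
      ⋂ r : Fin n, (fun ω => (corner (fun i => X i ω) T e, X r ω)) ⁻¹'
        {z | z.2 ∈ rowSet T e z.1 r} := by
    ext ω; simp [IsSupport]
  rw [this]
  exact MeasurableSet.iInter fun r =>
    ((measurable_corner hX T e).prodMk (hX r)) (measurableSet_setOf_mem_rowSet T e r)

lemma iIndepFun_entries (hX : ∀ i, Measurable (X i)) (hind : iIndepFun X P)
    (hcoord : ∀ i, iIndepFun (fun (j : Fin d) (ω : Ω) => X i ω j) P) :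
    iIndepFun (fun (q : ℕ × Fin d) ω => X q.1 ω q.2) P :=
  iIndepFun_uncurry' (X := fun i j ω => X i ω j)
    (fun i j => (measurable_pi_apply j).comp (hX i)) hind hcoord

lemma ae_generalPosition [IsProbabilityMeasure P] (hX : ∀ i, Measurable (X i))
    (hent : iIndepFun (fun (q : ℕ × Fin d) ω => X q.1 ω q.2) P)
    (hlaw : ∀ i (j : Fin d), P.map (fun ω => X i ω j) = volume.restrict (Set.Ioo 0 1)) (n : ℕ) :
    ∀ᵐ ω ∂P, GeneralPosition (fun i => X i ω) n := by
  have hXij : ∀ i (j : Fin d), Measurable fun ω => X i ω j := fun i j =>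
    (measurable_pi_apply j).comp (hX i)
  refine Filter.Eventually.and ?_ ?_
  · refine ae_all_iff.2 fun r => ae_all_iff.2 fun l => ?_
    refine ae_of_ae_map (p := fun x => x ∈ Set.Ioo (0 : ℝ) 1) (hXij r l).aemeasurable ?_
    rw [hlaw]
    exact ae_restrict_mem measurableSet_Ioo
  · refine ae_all_iff.2 fun l => ?_
    have hne : ∀ᵐ ω ∂P, ∀ r s : Fin n, r ≠ s → X r ω l ≠ X s ω l := by
      refine ae_all_iff.2 fun r => ae_all_iff.2 fun s => ae_all_iff.2 fun hrs => ?_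
      have : NullSingletonClass (P.map fun ω => X s ω l) := by rw [hlaw]; infer_instance
      refine ae_ne_of_indepFun (hXij r l) (hXij s l) ?_
      exact hent.indepFun (i := ((r : ℕ), l)) (j := ((s : ℕ), l))
        fun h => hrs (Fin.ext (congrArg Prod.fst h))
    filter_upwards [hne] with ω hω r s hrs
    by_contra hne
    exact hω r s hne hrs

/-- The probability that one observation exceeds `g` in the coordinates of `S`. -/
lemma measure_forall_mem_lt (hcoord : ∀ i, iIndepFun (fun (j : Fin d) (ω : Ω) => X i ω j) P)
    (hX : ∀ i, Measurable (X i))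
    (hlaw : ∀ i (j : Fin d), P.map (fun ω => X i ω j) = volume.restrict (Set.Ioo 0 1))
    {g : Fin d → ℝ} (S : Finset (Fin d)) (hg : ∀ l ∈ S, g l ∈ Set.Ioo (0 : ℝ) 1) (r : ℕ) :
    P {ω | ∀ l ∈ S, g l < X r ω l} = ENNReal.ofReal (∏ l ∈ S, (1 - g l)) := by
  have h := (hcoord r).measure_inter_preimage_eq_mul S (sets := fun l => Set.Ioi (g l))
    fun l _ => measurableSet_Ioi
  rw [ENNReal.ofReal_prod_of_nonneg fun l hl => by linarith [(hg l hl).2]]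
  convert h using 1
  · congr 1; ext ω; simp
  · refine Finset.prod_congr rfl fun l hl => ?_
    rw [← Measure.map_apply (f := fun ω => X r ω l) ((measurable_pi_apply l).comp (hX r))
      measurableSet_Ioi, hlaw r l, Measure.restrict_apply measurableSet_Ioi, Set.inter_comm,
      Set.Ioo_inter_Ioi, max_eq_right (hg l hl).1.le, Real.volume_Ioo]

lemma prod_prod_erase {ι : Type*} [DecidableEq ι] (T : Finset ι) (f : ι → ℝ) :
    ∏ j : T, ∏ l ∈ T.erase j, f l = (∏ l ∈ T, f l) ^ (T.card - 1) := by
  rw [Finset.prod_coe_sort T fun j => ∏ l ∈ T.erase j, f l,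
    Finset.prod_comm' (t' := T) (s' := fun l => T.erase l)]
  · rw [← Finset.prod_pow]
    refine Finset.prod_congr rfl fun l hl => ?_
    rw [Finset.prod_const, Finset.card_erase_of_mem hl]
  · intro j l
    simp only [Finset.mem_erase]
    tauto

/-- For a fixed point `g`, the probability that the observations satisfy all the conditions for
`g` to be a generator supported by `e`. -/
lemma measure_forall_mem_rowSet [IsProbabilityMeasure P] (hind : iIndepFun X P)
    (hcoord : ∀ i, iIndepFun (fun (j : Fin d) (ω : Ω) => X i ω j) P)
    (hX : ∀ i, Measurable (X i))
    (hlaw : ∀ i (j : Fin d), P.map (fun ω => X i ω j) = volume.restrict (Set.Ioo 0 1))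
    {n : ℕ} (T : Finset (Fin d)) (e : T ↪ Fin n) {g : Fin d → ℝ}
    (hg : ∀ l ∈ T, g l ∈ Set.Ioo (0 : ℝ) 1) :
    P {ω | ∀ r : Fin n, X r ω ∈ rowSet T e g r} =
      ENNReal.ofReal ((∏ l ∈ T, (1 - g l)) ^ (T.card - 1) *
        (1 - ∏ l ∈ T, (1 - g l)) ^ (n - T.card)) := by
  classical
  have hindn : iIndepFun (fun r : Fin n => X r) P := hind.precomp Fin.val_injective
  have hmeas : ∀ r : Fin n, MeasurableSet (rowSet T e g r) := fun r =>
    measurable_prodMk_left (x := g) (measurableSet_setOf_mem_rowSet T e r)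
  have hprod := hindn.measure_inter_preimage_eq_mul Finset.univ
    (sets := fun r => rowSet T e g r) fun r _ => hmeas r
  have hrange : ∀ j : T, P (X (e j) ⁻¹' rowSet T e g (e j)) =
      ENNReal.ofReal (∏ l ∈ T.erase j, (1 - g l)) := by
    intro j
    rw [← measure_forall_mem_lt hcoord hX hlaw (T.erase j)
      (fun l hl => hg l (Finset.mem_of_mem_erase hl)) (e j)]
    congr 1
    ext ω
    simp only [rowSet, Set.mem_preimage, Set.mem_ofPred_eq, Set.mem_range_self, iff_true,
      Finset.mem_erase, ne_eq, EmbeddingLike.apply_eq_iff_eq]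
    constructor
    · exact fun h l hl => h ⟨l, hl.2⟩ fun h' => hl.1 (congrArg Subtype.val h')
    · exact fun h l hl => h l ⟨fun h' => hl (Subtype.ext h'), l.2⟩
  have h01 : ∀ l ∈ T, 0 ≤ 1 - g l ∧ 1 - g l ≤ 1 := fun l hl =>
    ⟨by linarith [(hg l hl).2], by linarith [(hg l hl).1]⟩
  have hq0 : 0 ≤ ∏ l ∈ T, (1 - g l) := Finset.prod_nonneg fun l hl => (h01 l hl).1
  have hq1 : ∏ l ∈ T, (1 - g l) ≤ 1 :=
    Finset.prod_le_one (fun l hl => (h01 l hl).1) fun l hl => (h01 l hl).2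
  have hcompl : ∀ r : Fin n, r ∉ Set.range e → P (X r ⁻¹' rowSet T e g r) =
      ENNReal.ofReal (1 - ∏ l ∈ T, (1 - g l)) := by
    intro r hr
    have hset : X r ⁻¹' rowSet T e g r = {ω | ∀ l ∈ T, g l < X r ω l}ᶜ := by
      ext ω
      simp only [rowSet, Set.mem_preimage, Set.mem_ofPred_eq, hr, iff_false, Set.mem_compl_iff]
      refine not_congr ⟨fun h l hl => h ⟨l, hl⟩ fun h' => hr ⟨_, h'⟩, fun h l _ => h l l.2⟩
    have hm : MeasurableSet {ω | ∀ l ∈ T, g l < X r ω l} := by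
      rw [← compl_compl {ω | ∀ l ∈ T, g l < X r ω l}, ← hset]
      exact ((hX r) (hmeas r)).compl
    rw [hset, prob_compl_eq_one_sub hm, measure_forall_mem_lt hcoord hX hlaw T hg,
      ENNReal.ofReal_sub _ hq0, ENNReal.ofReal_one]
  have hinter : {ω | ∀ r : Fin n, X r ω ∈ rowSet T e g r} =
      ⋂ r ∈ Finset.univ, X (r : Fin n) ⁻¹' rowSet T e g r := by
    ext ω; simp
  rw [hinter, hprod, ← Finset.prod_mul_prod_compl (Finset.univ.map e), Finset.prod_map,
    Finset.prod_congr rfl fun j _ => hrange j,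
    Finset.prod_congr rfl fun r hr => hcompl r (by simpa using hr), Finset.prod_const,
    Finset.card_compl, Finset.card_map, Finset.card_univ, Fintype.card_coe, Fintype.card_fin,
    ← ENNReal.ofReal_prod_of_nonneg, prod_prod_erase,
    ← ENNReal.ofReal_pow (by linarith), ← ENNReal.ofReal_mul (by positivity)]
  exact fun j _ => Finset.prod_nonneg fun l hl => (h01 l (Finset.mem_of_mem_erase hl)).1

/-- The coordinates of `corner` are independent of all other entries, on which alone the
conditions of `rowSet` depend; hence the corner may be frozen. -/
lemma measure_isSupport_eq_lintegral [IsProbabilityMeasure P] (hX : ∀ i, Measurable (X i))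
    (hent : iIndepFun (fun (q : ℕ × Fin d) ω => X q.1 ω q.2) P)
    {n : ℕ} (T : Finset (Fin d)) (e : T ↪ Fin n) :
    P {ω | IsSupport (fun i => X i ω) T e} =
      ∫⁻ ω, P {ω' | ∀ r : Fin n, X r ω' ∈ rowSet T e (corner (fun i => X i ω) T e) r} ∂P := by
  classical
  set D : Finset (ℕ × Fin d) := Finset.univ.image fun l : T => ((e l : ℕ), (l : Fin d)) with hD
  set D' : Finset (ℕ × Fin d) := (Finset.range n ×ˢ Finset.univ) \ D with hD'
  have hXq : ∀ q : ℕ × Fin d, Measurable fun ω => X q.1 ω q.2 := fun q =>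
    (measurable_pi_apply q.2).comp (hX q.1)
  have hindep := hent.indepFun_finset D D' Finset.disjoint_sdiff hXq
  -- the corner as a function of the entries in `D`, and the remaining entries with those of `D`
  -- replaced by `0`
  set cornerMap : (D → ℝ) → Fin d → ℝ := fun y l =>
    if h : l ∈ T then y ⟨(e ⟨l, h⟩, l), Finset.mem_image.2 ⟨⟨l, h⟩, Finset.mem_univ _, rfl⟩⟩
    else 0
  set restMap : (D' → ℝ) → Fin n → Fin d → ℝ := fun y r l =>
    if h : ((r : ℕ), l) ∈ D' then y ⟨(r, l), h⟩ else 0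
  have hcornerMap : Measurable cornerMap := by
    refine measurable_pi_lambda _ fun l => ?_
    by_cases hl : l ∈ T <;>
      simp only [cornerMap, hl, dif_pos, dif_neg, not_false_eq_true] <;> fun_prop
  have hrestMap : Measurable restMap := by
    refine measurable_pi_lambda _ fun r => measurable_pi_lambda _ fun l => ?_
    by_cases hl : ((r : ℕ), l) ∈ D' <;>
      simp only [restMap, hl, dif_pos, dif_neg, not_false_eq_true] <;> fun_prop
  set W : Ω → Fin n → Fin d → ℝ := fun ω => restMap fun q => X q.1.1 ω q.1.2
  have hWm : Measurable W := hrestMap.comp (measurable_pi_lambda _ fun q => hXq q)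
  have hGW : IndepFun (fun ω => corner (fun i => X i ω) T e) W P := hindep.comp hcornerMap hrestMap
  have hrow : ∀ g (r : Fin n) ω, X r ω ∈ rowSet T e g r ↔ W ω r ∈ rowSet T e g r := by
    intro g r ω
    refine iff_congr (forall_congr' fun l => imp_congr_right fun hl => ?_) Iff.rfl
    have hmem : ((r : ℕ), (l : Fin d)) ∈ D' := by
      simp only [hD', hD, Finset.mem_sdiff, Finset.mem_product, Finset.mem_range, r.2,
        Finset.mem_univ, Finset.mem_image, true_and, and_self, Prod.mk.injEq, not_exists, not_and]
      intro k hk hkl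
      exact hl (by rw [← Fin.ext hk, Subtype.ext hkl])
    simp only [W, restMap, dif_pos hmem]
  have hBm : MeasurableSet {z : (Fin d → ℝ) × (Fin n → Fin d → ℝ) |
      ∀ r : Fin n, z.2 r ∈ rowSet T e z.1 r} := by
    rw [Set.ofPred_forall]
    refine MeasurableSet.iInter fun r => ?_
    have : Measurable fun z : (Fin d → ℝ) × (Fin n → Fin d → ℝ) => (z.1, z.2 r) := by fun_prop
    exact this (measurableSet_setOf_mem_rowSet T e r)
  have h := measure_setOf_pair_mem (measurable_corner hX T e) hWm hGW hBm
  simp only [Set.mem_ofPred_eq, ← hrow] at h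
  exact h

theorem measureReal_isSupport [IsProbabilityMeasure P] (hX : ∀ i, Measurable (X i))
    (hind : iIndepFun X P)
    (hcoord : ∀ i, iIndepFun (fun (j : Fin d) (ω : Ω) => X i ω j) P)
    (hlaw : ∀ i (j : Fin d), P.map (fun ω => X i ω j) = volume.restrict (Set.Ioo 0 1))
    {n a : ℕ} (T : Finset (Fin d)) (e : T ↪ Fin n) (hT : T.card = a + 1) :
    P.real {ω | IsSupport (fun i => X i ω) T e} = logBeta a n / (a ! : ℝ) := by
  have hent := iIndepFun_entries hX hind hcoord
  set U : T → Ω → ℝ := fun l ω => 1 - X (e l) ω l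
  have hUm : ∀ l, Measurable (U l) := fun l =>
    measurable_const.sub ((measurable_pi_apply _).comp (hX _))
  have hUind : iIndepFun U P := by
    have h := hent.precomp (g := fun l : T => ((e l : ℕ), (l : Fin d)))
      fun l k h => Subtype.ext (congrArg Prod.snd h)
    exact h.comp (fun _ x => 1 - x) fun _ => by fun_prop
  have hUlaw : ∀ l, P.map (U l) = volume.restrict (Set.Ioo 0 1) := fun l => by
    have h := Measure.map_map (μ := P) (f := fun ω => X (e l) ω l) (g := fun x : ℝ => 1 - x)
      (by fun_prop) ((measurable_pi_apply _).comp (hX _))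
    rw [hlaw, map_one_sub_restrict_Ioo] at h
    exact h.symm
  have hlawU := map_prod_eq_uniformProdLaw hUm hUind hUlaw Finset.univ a (by simpa using hT)
  set H : ℝ → ℝ := fun p => p ^ a * (1 - p) ^ (n - (a + 1)) with hH
  have hHm : Measurable H := by fun_prop
  have hPH : P {ω | IsSupport (fun i => X i ω) T e} =
      ∫⁻ ω, ENNReal.ofReal (H (∏ l : T, U l ω)) ∂P := by
    rw [measure_isSupport_eq_lintegral hX hent T e]
    refine lintegral_congr_ae ?_
    filter_upwards [ae_generalPosition hX hent hlaw n] with ω hω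
    rw [measure_forall_mem_rowSet hind hcoord hX hlaw T e fun l hl => by
      rw [corner_of_mem e ⟨l, hl⟩]; exact hω.1 _ _]
    rw [hT, Nat.add_sub_cancel, ← Finset.prod_coe_sort T]
    simp only [corner_of_mem, hH, U]
  rw [← lintegral_map (f := fun p => ENNReal.ofReal (H p)) (by fun_prop) (by fun_prop), hlawU,
    lintegral_uniformProdLaw a (by fun_prop)] at hPH
  rw [measureReal_def, hPH, logBeta, ← integral_div,
    integral_eq_lintegral_of_nonneg_ae _ (by fun_prop)]
  · congr 1
    refine setLIntegral_congr_fun measurableSet_Ioo fun p hp => ?_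
    have h0 : 0 ≤ H p := mul_nonneg (pow_nonneg hp.1.le _) (pow_nonneg (by linarith [hp.2]) _)
    rw [← ENNReal.ofReal_mul' h0]
    congr 1
    simp only [hH]; ring
  · refine (ae_restrict_iff' measurableSet_Ioo).2 (Eventually.of_forall fun p hp => ?_)
    have h1 : 0 ≤ 1 - p := by linarith [hp.2]
    have h2 : 0 ≤ -Real.log p := by linarith [Real.log_nonpos hp.1.le hp.2.le]
    have h3 : 0 ≤ p := hp.1.le
    simp only [Pi.zero_apply]
    positivity

lemma measureReal_isSupport_empty
    {n : ℕ} (hn : 0 < n) (e : (∅ : Finset (Fin d)) ↪ Fin n) :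
    P.real {ω | IsSupport (fun i => X i ω) ∅ e} = 0 := by
  have hempty : {ω | IsSupport (fun i => X i ω) ∅ e} = ∅ := by
    refine Set.eq_empty_of_forall_notMem fun ω hω => ?_
    obtain ⟨l, -⟩ := (hω ⟨0, hn⟩).1 fun l => absurd l.2 (Finset.notMem_empty _)
    exact absurd l.2 (Finset.notMem_empty _)
  rw [hempty, measureReal_empty]

lemma ncard_generators_ae_eq [IsProbabilityMeasure P] (hX : ∀ i, Measurable (X i))
    (hent : iIndepFun (fun (q : ℕ × Fin d) ω => X q.1 ω q.2) P)
    (hlaw : ∀ i (j : Fin d), P.map (fun ω => X i ω j) = volume.restrict (Set.Ioo 0 1)) (n : ℕ) :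
    (fun ω => ((generators (fun i => X i ω) n).ncard : ℝ)) =ᵐ[P] fun ω =>
      ∑ T : Finset (Fin d), ∑ e : T ↪ Fin n,
        {ω | IsSupport (fun i => X i ω) T e}.indicator 1 ω := by
  filter_upwards [ae_generalPosition hX hent hlaw n] with ω hω
  exact hω.ncard_generators

lemma integrable_indicator_isSupport [IsProbabilityMeasure P] (hX : ∀ i, Measurable (X i))
    {n : ℕ} (T : Finset (Fin d)) (e : T ↪ Fin n) :
    Integrable ({ω | IsSupport (fun i => X i ω) T e}.indicator (1 : Ω → ℝ)) P :=
  (integrable_const (1 : ℝ)).indicator (measurableSet_isSupport hX T e)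

lemma integrable_ncard_generators [IsProbabilityMeasure P] (hX : ∀ i, Measurable (X i))
    (hent : iIndepFun (fun (q : ℕ × Fin d) ω => X q.1 ω q.2) P)
    (hlaw : ∀ i (j : Fin d), P.map (fun ω => X i ω j) = volume.restrict (Set.Ioo 0 1)) (n : ℕ) :
    Integrable (fun ω => ((generators (fun i => X i ω) n).ncard : ℝ)) P := by
  refine Integrable.congr ?_ (ncard_generators_ae_eq hX hent hlaw n).symm
  exact integrable_finsetSum _ fun T _ => integrable_finsetSum _ fun e _ =>
    integrable_indicator_isSupport hX T e

/-- The exact expectation, grouped by the number `a + 1` of positive coordinates of the generator.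
No generator is `0`, because the first observation dominates the origin. -/
theorem integral_ncard_generators [IsProbabilityMeasure P] (hX : ∀ i, Measurable (X i))
    (hind : iIndepFun X P)
    (hcoord : ∀ i, iIndepFun (fun (j : Fin d) (ω : Ω) => X i ω j) P)
    (hlaw : ∀ i (j : Fin d), P.map (fun ω => X i ω j) = volume.restrict (Set.Ioo 0 1))
    {n : ℕ} (hn : 0 < n) :
    ∫ ω, ((generators (fun i => X i ω) n).ncard : ℝ) ∂P =
      ∑ a ∈ Finset.range d,
        (d.choose (a + 1) : ℝ) / (a ! : ℝ) * ((n.descFactorial (a + 1) : ℝ) * logBeta a n) := by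
  classical
  have hent := iIndepFun_entries hX hind hcoord
  -- the contribution of the supports with `m` elements
  set v : ℕ → ℝ := fun m =>
    if m = 0 then 0 else n.descFactorial m * (logBeta (m - 1) n / ((m - 1)! : ℝ)) with hv
  have hT : ∀ T : Finset (Fin d),
      ∑ e : T ↪ Fin n, P.real {ω | IsSupport (fun i => X i ω) T e} = v T.card := by
    intro T
    rcases T.eq_empty_or_nonempty with rfl | hne
    · simp [hv, measureReal_isSupport_empty hn]
    · obtain ⟨a, ha⟩ := Nat.exists_eq_succ_of_ne_zero hne.card_pos.ne'
      rw [Finset.sum_congr rfl fun e _ => measureReal_isSupport hX hind hcoord hlaw T e ha]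
      simp [hv, ha, Fintype.card_embedding_eq]
  rw [integral_congr_ae (ncard_generators_ae_eq hX hent hlaw n),
    integral_finsetSum _ fun T _ => integrable_finsetSum _ fun e _ =>
      integrable_indicator_isSupport hX T e]
  simp_rw [integral_finsetSum Finset.univ fun e _ => integrable_indicator_isSupport hX _ e,
    integral_indicator_one (measurableSet_isSupport hX _ _), hT]
  rw [← Finset.powerset_univ, Finset.sum_powerset_apply_card, Finset.card_univ, Fintype.card_fin,
    Finset.sum_range_succ']
  simp only [hv, if_true, smul_zero, add_zero, Nat.add_eq_zero_iff, one_ne_zero, and_false,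
    if_false, Nat.add_sub_cancel, nsmul_eq_mul]
  exact Finset.sum_congr rfl fun a _ => by ring

end Observations

end Probability

/-! ### Expansion in powers of the logarithm -/

lemma coeff_zero {d : ℕ} (hd : 1 ≤ d) : coeff d 0 = 1 := by
  obtain ⟨a, rfl⟩ : ∃ a, d = a + 1 := ⟨d - 1, by omega⟩
  have h := Real.Gamma_nat_eq_factorial a
  have ha : (a ! : ℝ) ≠ 0 := by positivity
  simp [coeff, h, ha]

lemma choose_div_factorial {a k : ℕ} (hk : k ≤ a) :
    (a.choose k : ℝ) / (a ! : ℝ) = 1 / ((k ! : ℝ) * ((a - k)! : ℝ)) := by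
  rw [Nat.cast_choose ℝ hk]
  have : (a ! : ℝ) ≠ 0 := by positivity
  field_simp

/-- Collecting the contributions of the numbers `a + 1` of positive coordinates by powers of `L`:
the term of index `k` in `logPoly a` contributes to the power `L ^ (d - 1 - j)` with
`j = d - 1 - a + k`. -/
theorem sum_logPoly_eq_sum_coeff {d : ℕ} {L : ℝ} (hL : L ≠ 0) :
    ∑ a ∈ Finset.range d, (d.choose (a + 1) : ℝ) / (a ! : ℝ) * logPoly a L =
      L ^ (d - 1) * ∑ j ∈ Finset.range d, coeff d j * L ^ (-(j : ℤ)) := by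
  simp only [logPoly, coeff, Finset.mul_sum, Finset.sum_mul]
  rw [Finset.sum_sigma', Finset.sum_sigma']
  refine Finset.sum_nbij' (fun q => ⟨d - 1 - q.1 + q.2, q.2⟩) (fun q => ⟨d - 1 - q.1 + q.2, q.2⟩)
    ?_ ?_ ?_ ?_ ?_
  · rintro ⟨a, k⟩ h
    simp only [Finset.mem_sigma, Finset.mem_range] at h ⊢
    omega
  · rintro ⟨a, k⟩ h
    simp only [Finset.mem_sigma, Finset.mem_range] at h ⊢
    omega
  · rintro ⟨a, k⟩ h
    simp only [Finset.mem_sigma, Finset.mem_range] at h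
    simp only [Sigma.mk.injEq, heq_eq_eq, and_true]
    omega
  · rintro ⟨a, k⟩ h
    simp only [Finset.mem_sigma, Finset.mem_range] at h
    simp only [Sigma.mk.injEq, heq_eq_eq, and_true]
    omega
  · rintro ⟨a, k⟩ h
    simp only [Finset.mem_sigma, Finset.mem_range] at h
    have hpow : L ^ (d - 1) * L ^ (-((d - 1 - a + k : ℕ) : ℤ)) = L ^ (a - k) := by
      rw [← zpow_natCast, ← zpow_add₀ hL, ← zpow_natCast]
      congr 1
      omega
    have hm : d - (d - 1 - a + k) + k = a + 1 := by omega
    have hs : d - 1 - (d - 1 - a + k) = a - k := by omega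
    simp only [hm, hs]
    have hc := choose_div_factorial (show k ≤ a by omega)
    rw [← hpow]
    calc _ = (d.choose (a + 1) : ℝ) * ((-1) ^ k * iteratedDeriv k Real.Gamma ((a + 1 : ℕ) : ℝ)) *
          ((a.choose k : ℝ) / (a ! : ℝ)) *
          (L ^ (d - 1) * L ^ (-((d - 1 - a + k : ℕ) : ℤ))) := by ring
      _ = _ := by rw [hc]; ring

/-- The asymptotic expansion of the sum that expresses the expectation. -/
theorem sum_descFactorial_mul_logBeta_sub_isBigO (d : ℕ) :
    (fun n : ℕ => ∑ a ∈ Finset.range d,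
        (d.choose (a + 1) : ℝ) / (a ! : ℝ) * ((n.descFactorial (a + 1) : ℝ) * logBeta a n) -
      Real.log n ^ (d - 1) *
        ∑ j ∈ Finset.range d, coeff d j * Real.log n ^ (-(j : ℤ))) =O[atTop]
      fun n : ℕ => (n : ℝ)⁻¹ * Real.log n ^ (d - 1) := by
  have hterm : (fun n : ℕ => ∑ a ∈ Finset.range d, (d.choose (a + 1) : ℝ) / (a ! : ℝ) *
      ((n.descFactorial (a + 1) : ℝ) * logBeta a n - logPoly a (Real.log n))) =O[atTop]
      fun n : ℕ => (n : ℝ)⁻¹ * Real.log n ^ (d - 1) := by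
    refine IsBigO.fun_sum fun a ha => IsBigO.const_mul_left ?_ _
    refine (descFactorial_mul_logBeta_sub_logPoly_isBigO a).trans ?_
    refine (isBigO_refl _ _).mul (log_pow_isBigO_log_pow ?_)
    have := Finset.mem_range.1 ha
    omega
  refine hterm.congr' ?_ .rfl
  filter_upwards [eventually_one_le_log_natCast] with n hL
  rw [← sum_logPoly_eq_sum_coeff (by linarith), ← Finset.sum_sub_distrib]
  exact Finset.sum_congr rfl fun a _ => by ring

end ParetoRecords

theorem theoremT {Ω : Type*} [MeasurableSpace Ω] (P : Measure Ω) [IsProbabilityMeasure P]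
    (d : ℕ) (hd : 1 ≤ d)
    (X : ℕ → Ω → Fin d → ℝ)
    (hX_meas : ∀ i, Measurable (X i))
    (hX_indep : iIndepFun X P)
    (hX_coord : ∀ i, iIndepFun (fun (j : Fin d) (ω : Ω) => X i ω j) P)
    (hX_unif : ∀ i (j : Fin d), pdf.IsUniform (fun ω => X i ω j) (Set.Ico (0 : ℝ) 1) P volume) :
    (∀ (n : ℕ) (ω : Ω), (ParetoRecords.generators (fun i => X i ω) n).Finite) ∧
    (∀ n : ℕ, Integrable
      (fun ω => ((ParetoRecords.generators (fun i => X i ω) n).ncard : ℝ)) P) ∧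
    ((fun n : ℕ =>
        (∫ ω, ((ParetoRecords.generators (fun i => X i ω) n).ncard : ℝ) ∂P) -
          Real.log n ^ (d - 1) *
            ∑ j ∈ Finset.range d, ParetoRecords.coeff d j * Real.log n ^ (-(j : ℤ)))
      =O[atTop] fun n : ℕ => (n : ℝ)⁻¹ * Real.log n ^ (d - 1)) ∧
    ParetoRecords.coeff d 0 = 1 := by
  have hlaw : ∀ i (j : Fin d), P.map (fun ω => X i ω j) = volume.restrict (Set.Ioo 0 1) :=
    fun i j => ParetoRecords.map_eq_restrict_Ioo_of_isUniform (hX_unif i j)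
  have hent := ParetoRecords.iIndepFun_entries hX_meas hX_indep hX_coord
  refine ⟨fun n ω => ParetoRecords.finite_generators _ n,
    fun n => ParetoRecords.integrable_ncard_generators hX_meas hent hlaw n, ?_,
    ParetoRecords.coeff_zero hd⟩
  refine (ParetoRecords.sum_descFactorial_mul_logBeta_sub_isBigO d).congr' ?_ .rfl
  filter_upwards [eventually_gt_atTop 0] with n hn
  rw [ParetoRecords.integral_ncard_generators hX_meas hX_indep hX_coord hlaw hn]
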